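/- Regard $M_2(\mathbb{C})$, with elementary matrices $E_{i,j}$, as a Frobenius algebra with the form $\kappa(X,Y)=\mathrm{Tr}(XY)$: the counit is $\mathrm{Tr}$ and the comultiplication is $\Delta(X)=\sum_{i,j}(XE_{i,j})\otimes E_{j,i}$. For $S,T\in\mathrm{End}_{\mathbb{C}}(M_2(\mathbb{C}))$ put $T^*(X)=\sum_{i,j}\mathrm{Tr}(X\,T(E_{i,j}))\,E_{j,i}$ and $(S*T)(X)=\sum_{i,j}S(XE_{i,j})\,T(E_{j,i})$. A biprojection is a linear map $T$ with $T^*=T$, $T(\mathrm{id})=\mathrm{id}$, $T\circ T=T$ and $T*T=\lambda T$ for some nonzero scalar $\lambda$. Let $T\in\mathrm{End}_{\mathbb{C}}(M_2(\mathbb{C}))$ and $A_{i,j}=T(E_{i,j})$. Then $T$ is a biprojection with $\lambda=1$ if and only if $(A_{1,1},A_{1,2},A_{2,1},A_{2,2})$ is one of the following: 1. $\begin{pmatrix}1&-s\\0&0\end{pmatrix}$, $\begin{pmatrix}0&0\\0&0\end{pmatrix}$, $\begin{pmatrix}-s&2s^2\\0&s\end{pmatrix}$, $\begin{pmatrix}0&s\\0&1\end{pmatrix}$,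 with $s\in\mathbb{C}$; 2. $\begin{pmatrix}\frac12&0\\0&\frac12\end{pmatrix}$, $\begin{pmatrix}0&\frac12\\\frac1{4u}&0\end{pmatrix}$, $\begin{pmatrix}0&u\\\frac12&0\end{pmatrix}$, $\begin{pmatrix}\frac12&0\\0&\frac12\end{pmatrix}$, with $u\in\mathbb{C}\setminus\{0\}$; 3. $\begin{pmatrix}k&\frac{(k-1)(k-1/2)}{t}\\-t&1-k\end{pmatrix}$, $\begin{pmatrix}-t&1-k\\\frac{t^2}{k-1/2}&t\end{pmatrix}$, $\begin{pmatrix}\frac{(k-1)(k-1/2)}{t}&\frac{(k-1)^2(k-1/2)}{t^2}\\1-k&-\frac{(k-1)(k-1/2)}{t}\end{pmatrix}$, $\begin{pmatrix}1-k&-\frac{(k-1)(k-1/2)}{t}\\t&k\end{pmatrix}$, with $k\in\mathbb{C}\setminus\{1/2\}$ and $t\in\mathbb{C}\setminus\{0\}$. Moreover, for every such $T$ the image of $T$ is a two-dimensional unital subalgebra of $M_2(\mathbb{C})$. It is the unital subalgebra generated by $A_{1,2}$ whenever $A_{1,2}\neq0$, and the unital subalgebra generated by $A_{2,1}$ whenever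 $A_{2,1}\neq0$. If $A_{1,2}=A_{2,1}=0$, then $T(X)=X_{1,1}E_{1,1}+X_{2,2}E_{2,2}$ for all $X$, and its image is the subalgebra of diagonal matrices. -/

import Mathlib

open scoped TensorProduct

namespace MatrixFrobenius

variable {𝕜 : Type*} [Field 𝕜] {n : Type*} [Fintype n] [DecidableEq n]

/-- The multiplication `m : X ⊗ Y ↦ X Y` of the matrix algebra. -/
noncomputable def mulMap : Matrix n n 𝕜 ⊗[𝕜] Matrix n n 𝕜 →ₗ[𝕜] Matrix n n 𝕜 :=
  LinearMap.mul' 𝕜 (Matrix n n 𝕜)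

/-- The unit `e : c ↦ c • 1` of the matrix algebra. -/
def unitMap : 𝕜 →ₗ[𝕜] Matrix n n 𝕜 :=
  Algebra.linearMap 𝕜 (Matrix n n 𝕜)

/-- The counit of the Frobenius algebra of matrices with the form `κ(X, Y) = Tr (X Y)`:
the (unnormalized) trace. -/
def counit : Matrix n n 𝕜 →ₗ[𝕜] 𝕜 :=
  Matrix.traceLinearMap n 𝕜 𝕜

/-- The comultiplication of the Frobenius algebra of matrices with the form
`κ(X, Y) = Tr (X Y)`, that is `Δ X = ∑ i j, (X E i j) ⊗ E j i`. -/
noncomputable def comul : Matrix n n 𝕜 →ₗ[𝕜] Matrix n n 𝕜 ⊗[𝕜] Matrix n n 𝕜 :=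
  ∑ i, ∑ j, (TensorProduct.mk 𝕜 (Matrix n n 𝕜) (Matrix n n 𝕜)).flip (Matrix.single j i 1) ∘ₗ
    LinearMap.mulRight 𝕜 (Matrix.single i j (1 : 𝕜))

/-- The evaluation `ev = ε ∘ m`. -/
noncomputable def evMap : Matrix n n 𝕜 ⊗[𝕜] Matrix n n 𝕜 →ₗ[𝕜] 𝕜 :=
  counit ∘ₗ mulMap

/-- The coevaluation `coev = Δ ∘ e`. -/
noncomputable def coevMap : 𝕜 →ₗ[𝕜] Matrix n n 𝕜 ⊗[𝕜] Matrix n n 𝕜 :=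
  comul ∘ₗ unitMap

/-- The dual `T^* = (ev ⊗ id) ∘ (id ⊗ T ⊗ id) ∘ (id ⊗ coev)` of an endomorphism,
with the associator and the unitors written out. -/
noncomputable def dual (T : Module.End 𝕜 (Matrix n n 𝕜)) : Module.End 𝕜 (Matrix n n 𝕜) :=
  (TensorProduct.lid 𝕜 (Matrix n n 𝕜)).toLinearMap ∘ₗ
    (evMap.rTensor (Matrix n n 𝕜)) ∘ₗ
    (TensorProduct.assoc 𝕜 (Matrix n n 𝕜) (Matrix n n 𝕜) (Matrix n n 𝕜)).symm.toLinearMap ∘ₗ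
    ((T.rTensor (Matrix n n 𝕜)).lTensor (Matrix n n 𝕜)) ∘ₗ
    (coevMap.lTensor (Matrix n n 𝕜)) ∘ₗ
    (TensorProduct.rid 𝕜 (Matrix n n 𝕜)).symm.toLinearMap

/-- The convolution product `S * T = m ∘ (S ⊗ T) ∘ Δ`. -/
noncomputable def conv (S T : Module.End 𝕜 (Matrix n n 𝕜)) : Module.End 𝕜 (Matrix n n 𝕜) :=
  mulMap ∘ₗ TensorProduct.map S T ∘ₗ comul

theorem comul_apply (X : Matrix n n 𝕜) :
    comul X = ∑ i, ∑ j, (X * Matrix.single i j 1) ⊗ₜ[𝕜] Matrix.single j i (1 : 𝕜) := by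
  simp [comul, LinearMap.sum_apply]

theorem dual_apply (T : Module.End 𝕜 (Matrix n n 𝕜)) (X : Matrix n n 𝕜) :
    dual T X = ∑ i, ∑ j,
      (X * T (Matrix.single i j 1)).trace • Matrix.single j i (1 : 𝕜) := by
  simp [dual, coevMap, evMap, unitMap, counit, mulMap, comul_apply, TensorProduct.tmul_sum,
    -Matrix.smul_single]

theorem conv_apply (S T : Module.End 𝕜 (Matrix n n 𝕜)) (X : Matrix n n 𝕜) :
    conv S T X = ∑ i, ∑ j,
      S (X * Matrix.single i j 1) * T (Matrix.single j i (1 : 𝕜)) := by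
  simp [conv, mulMap, comul_apply]

/-- `T` is convolution-stable with constant `c`: `c ≠ 0` and `T * T = c T`. -/
def IsConvStable (c : 𝕜) (T : Module.End 𝕜 (Matrix n n 𝕜)) : Prop :=
  c ≠ 0 ∧ conv T T = c • T

/-- A biprojection: a selfdual unital idempotent that is convolution-stable for some constant. -/
structure IsBiprojection (T : Module.End 𝕜 (Matrix n n 𝕜)) : Prop where
  selfdual : dual T = T
  unital : T ∘ₗ unitMap = unitMap
  idempotent : T ∘ₗ T = T
  convStable : ∃ c : 𝕜, IsConvStable c T

end MatrixFrobenius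

/-! Selfdual means symmetric for the trace form, so a selfdual unital `T` fixes `1` and preserves
the traceless matrices, where it acts by a symmetric tensor with entries `p, m, n, w, q, r`. By
selfduality and idempotence, the trace of `(T * T)(1)` is the trace of `T` as an operator. If `T * T
= T` this is `Tr 1 = 2`, so the idempotent `T` has rank two and its traceless part is a rank one
projection `H ⊗ H`, where `H` is traceless and `H * H = 1`. Hence `T` is the orthogonal projection
onto the span of `1` and `H` (`exists_hasTensorEntries`, `IsUnitSquare.exists_root`); conversely
every such projection qualifies (`isBiprojection_involutionProjection`). The three families sort `H
= !![a, b; c, -a]` by whether `c` or `a` vanishes, and the image is the algebra generated by `H`. -/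

namespace MatrixFrobenius

/-! ### Duals and convolutions on matrix units -/

section Entries

variable {𝕜 : Type*} [Field 𝕜] {n : Type*} [Fintype n] [DecidableEq n]

theorem dual_single_apply (T : Module.End 𝕜 (Matrix n n 𝕜)) (k l i j : n) :
    dual T (Matrix.single k l 1) j i = T (Matrix.single i j 1) l k := by
  rw [dual_apply]
  simp only [Matrix.sum_apply, Matrix.smul_apply, Matrix.trace_single_mul, smul_eq_mul, one_mul,
    Matrix.single_apply, mul_ite, mul_one, mul_zero]
  rw [Finset.sum_eq_single i, Finset.sum_eq_single j]
  all_goals simp +contextual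

theorem conv_single (S T : Module.End 𝕜 (Matrix n n 𝕜)) (k l : n) :
    conv S T (Matrix.single k l 1) =
      ∑ j, S (Matrix.single k j 1) * T (Matrix.single j l 1) := by
  rw [conv_apply, Finset.sum_eq_single l]
  · simp
  · intro i _ hi
    refine Finset.sum_eq_zero fun j _ => ?_
    rw [Matrix.single_mul_single_of_ne _ _ _ _ hi.symm]
    simp
  · simp

theorem end_ext_single {S T : Module.End 𝕜 (Matrix n n 𝕜)}
    (h : ∀ k l, S (Matrix.single k l 1) = T (Matrix.single k l 1)) : S = T :=
  Matrix.ext_linearMap 𝕜 fun k l => LinearMap.ext_ring (h k l)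

end Entries

/-! ### Projections attached to traceless involutions -/

/-- The endomorphism `X ↦ (Tr X / 2) 1 + (Tr (H X) / 2) H`. -/
noncomputable def involutionProjection (H : Matrix (Fin 2) (Fin 2) ℂ) :
    Module.End ℂ (Matrix (Fin 2) (Fin 2) ℂ) where
  toFun X := (X.trace / 2) • 1 + ((H * X).trace / 2) • H
  map_add' X Y := by
    simp only [mul_add, Matrix.trace_add, add_div, add_smul]; abel
  map_smul' c X := by
    simp [mul_div_assoc, mul_smul]

theorem involutionProjection_apply (H X : Matrix (Fin 2) (Fin 2) ℂ) :
    involutionProjection H X = (X.trace / 2) • 1 + ((H * X).trace / 2) • H := rfl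

theorem involutionProjection_single (H : Matrix (Fin 2) (Fin 2) ℂ) (k l : Fin 2) :
    involutionProjection H (Matrix.single k l 1) =
      ((1 : Matrix (Fin 2) (Fin 2) ℂ) k l / 2) • 1 + (H l k / 2) • H := by
  rw [involutionProjection_apply, Matrix.trace_mul_single, MulOpposite.op_one, one_smul]
  congr 3
  fin_cases k <;> fin_cases l <;> simp

theorem involutionProjection_one {H : Matrix (Fin 2) (Fin 2) ℂ} (h : H.trace = 0) :
    involutionProjection H 1 = 1 := by
  simp [involutionProjection_apply, h]

theorem involutionProjection_self {H : Matrix (Fin 2) (Fin 2) ℂ} (h : H.trace = 0)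
    (hH : H * H = 1) : involutionProjection H H = H := by
  simp [involutionProjection_apply, h, hH]

theorem dual_involutionProjection (H : Matrix (Fin 2) (Fin 2) ℂ) :
    dual (involutionProjection H) = involutionProjection H := by
  refine end_ext_single fun k l => ?_
  ext j i
  rw [dual_single_apply, involutionProjection_single, involutionProjection_single]
  fin_cases k <;> fin_cases l <;> fin_cases i <;> fin_cases j <;> simp <;> ring

/-- On `E k l` the sum expands to `(δ_kl + 2 H_lk H + (H * H)_lk (H * H)) / 4`, and `H * H = 1`
merges the outer terms. -/
theorem conv_involutionProjection {H : Matrix (Fin 2) (Fin 2) ℂ} (h : H.trace = 0)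
    (hH : H * H = 1) :
    conv (involutionProjection H) (involutionProjection H) = involutionProjection H := by
  have e : H 0 0 * H 0 0 + H 0 1 * H 1 0 = 1 := by
    simpa [Matrix.mul_apply] using congrFun (congrFun hH 0) 0
  have h' : H 1 1 = -H 0 0 := by
    rw [Matrix.trace_fin_two] at h; linear_combination h
  refine end_ext_single fun k l => ?_
  rw [conv_single]
  ext j i
  simp only [involutionProjection_single, Matrix.mul_apply, Fin.sum_univ_two, Matrix.add_apply,
    Matrix.smul_apply, smul_eq_mul, Matrix.one_apply]
  fin_cases k <;> fin_cases l <;> fin_cases i <;> fin_cases j <;> simp [h'] <;> grind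

theorem isBiprojection_involutionProjection {H : Matrix (Fin 2) (Fin 2) ℂ} (h : H.trace = 0)
    (hH : H * H = 1) :
    IsBiprojection (involutionProjection H) ∧ IsConvStable 1 (involutionProjection H) := by
  have hc : IsConvStable 1 (involutionProjection H) :=
    ⟨one_ne_zero, by rw [conv_involutionProjection h hH, one_smul]⟩
  refine ⟨⟨dual_involutionProjection H, ?_, ?_, 1, hc⟩, hc⟩
  · refine LinearMap.ext_ring ?_
    simpa [unitMap] using involutionProjection_one h
  · ext1 X
    rw [LinearMap.comp_apply, involutionProjection_apply H X, map_add, map_smul, map_smul,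
      involutionProjection_one h, involutionProjection_self h hH]

theorem involution_mul_self {a b c : ℂ} (h : a ^ 2 + b * c = 1) :
    !![a, b; c, -a] * !![a, b; c, -a] = 1 := by
  ext i j
  fin_cases i <;> fin_cases j <;> simp [Matrix.mul_apply] <;>
    first | ring1 | linear_combination h

/-! ### Rank one tensors and their square roots -/

/-- The entries of a symmetric rank one tensor `v ⊗ v`, with `v = (a, b, c)` satisfying
`a ^ 2 + b * c = 1`. -/
structure IsUnitSquare (p m n w q r : ℂ) : Prop where
  add_eq_one : p + w = 1
  mul_pw : p * w = m * n
  mul_pq : p * q = m ^ 2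
  mul_pr : p * r = n ^ 2
  mul_mw : m * w = n * q
  mul_nw : n * w = m * r
  mul_qr : q * r = w ^ 2

/-- The products are the vanishing 2 × 2 minors. A nonzero diagonal entry, `p` or else `r`, supplies
a square root, and division by it gives the rest of `v`, which is unique only up to sign. -/
theorem IsUnitSquare.exists_root {p m n w q r : ℂ} (h : IsUnitSquare p m n w q r) :
    ∃ a b c : ℂ, a ^ 2 + b * c = 1 ∧ p = a ^ 2 ∧ m = a * b ∧ n = a * c ∧ w = b * c ∧
      q = b ^ 2 ∧ r = c ^ 2 := by
  obtain ⟨h1, h2, h3, h4, h5, h6, h7⟩ := h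
  by_cases hp : p = 0
  · subst hp
    have hm : m = 0 := by simpa using h3.symm
    have hn : n = 0 := by simpa using h4.symm
    have hw : w = 1 := by simpa using h1
    obtain ⟨c, hc⟩ := IsAlgClosed.exists_pow_nat_eq r (n := 2) (by norm_num)
    subst hm hn hw
    subst hc
    have hc : c ≠ 0 := by rintro rfl; simp at h7
    refine ⟨0, 1 / c, c, ?_, ?_, ?_, ?_, ?_, ?_, ?_⟩ <;> field_simp <;>
      try first | done | ring1 | linear_combination h7
  · obtain ⟨a, ha⟩ := IsAlgClosed.exists_pow_nat_eq p (n := 2) (by norm_num)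
    subst ha
    have ha : a ≠ 0 := by rintro rfl; simp at hp
    refine ⟨a, m / a, n / a, ?_, ?_, ?_, ?_, ?_, ?_, ?_⟩ <;> field_simp <;>
      try first
        | linear_combination h2
        | linear_combination h3
        | linear_combination h4
        | linear_combination a ^ 2 * h1 - h2

theorem isUnitSquare_of_root {a b c : ℂ} (h : a ^ 2 + b * c = 1) :
    IsUnitSquare (a ^ 2) (a * b) (a * c) (b * c) (b ^ 2) (c ^ 2) := by
  constructor <;> first | exact h | ring

/-- The values on the matrix units of the endomorphism attached to the symmetric tensor with
entries `p, m, n, w, q, r`. -/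
def HasTensorEntries (A : Fin 2 → Fin 2 → Matrix (Fin 2) (Fin 2) ℂ) (p m n w q r : ℂ) : Prop :=
  A 0 0 = !![(1 + p) / 2, m / 2; n / 2, (1 - p) / 2] ∧
  A 0 1 = !![n / 2, w / 2; r / 2, -(n / 2)] ∧
  A 1 0 = !![m / 2, q / 2; w / 2, -(m / 2)] ∧
  A 1 1 = !![(1 - p) / 2, -(m / 2); -(n / 2), (1 + p) / 2]

theorem hasTensorEntries_involutionProjection (a b c : ℂ) :
    HasTensorEntries (fun i j => involutionProjection !![a, b; c, -a] (Matrix.single i j 1))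
      (a ^ 2) (a * b) (a * c) (b * c) (b ^ 2) (c ^ 2) := by
  refine ⟨?_, ?_, ?_, ?_⟩ <;> ext i j <;> fin_cases i <;> fin_cases j <;>
    simp [involutionProjection_single] <;> ring

theorem HasTensorEntries.eq_of_eq {A B : Fin 2 → Fin 2 → Matrix (Fin 2) (Fin 2) ℂ}
    {p m n w q r : ℂ} (hA : HasTensorEntries A p m n w q r)
    (hB : HasTensorEntries B p m n w q r) : A = B := by
  obtain ⟨a1, a2, a3, a4⟩ := hA
  obtain ⟨b1, b2, b3, b4⟩ := hB
  funext i j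
  fin_cases i <;> fin_cases j <;> simp [*]

theorem eq_sum_single (T : Module.End ℂ (Matrix (Fin 2) (Fin 2) ℂ))
    (X : Matrix (Fin 2) (Fin 2) ℂ) :
    T X = X 0 0 • T (Matrix.single 0 0 1) + X 0 1 • T (Matrix.single 0 1 1) +
      (X 1 0 • T (Matrix.single 1 0 1) + X 1 1 • T (Matrix.single 1 1 1)) := by
  conv_lhs => rw [Matrix.matrix_eq_sum_single X]
  simp only [Fin.sum_univ_two, map_add, ← map_smul, Matrix.smul_single, smul_eq_mul, mul_one]

theorem HasTensorEntries.eq_involutionProjection {T : Module.End ℂ (Matrix (Fin 2) (Fin 2) ℂ)}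
    {p m n w q r : ℂ} (hT : HasTensorEntries (fun i j => T (Matrix.single i j 1)) p m n w q r)
    (h : IsUnitSquare p m n w q r) :
    ∃ a b c : ℂ, a ^ 2 + b * c = 1 ∧ T = involutionProjection !![a, b; c, -a] := by
  obtain ⟨a, b, c, habc, rfl, rfl, rfl, rfl, rfl, rfl⟩ := h.exists_root
  have := hT.eq_of_eq (hasTensorEntries_involutionProjection a b c)
  exact ⟨a, b, c, habc, end_ext_single fun k l => congrFun (congrFun this k) l⟩

theorem exists_hasTensorEntries {T : Module.End ℂ (Matrix (Fin 2) (Fin 2) ℂ)}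
    (hT : IsBiprojection T) (hc : IsConvStable 1 T) :
    ∃ p m n w q r : ℂ, IsUnitSquare p m n w q r ∧
      HasTensorEntries (fun i j => T (Matrix.single i j 1)) p m n w q r := by
  have hd : ∀ k l i j, T (Matrix.single k l 1) j i = T (Matrix.single i j 1) l k := fun k l i j => by
    rw [← dual_single_apply, hT.selfdual]
  have hu : T (Matrix.single 0 0 1) + T (Matrix.single 1 1 1) = 1 := by
    have h1 : T 1 = 1 := by simpa [unitMap] using LinearMap.congr_fun hT.unital 1
    rw [eq_sum_single T 1] at h1
    simpa using h1
  have hi : ∀ k l, T (T (Matrix.single k l 1)) = T (Matrix.single k l 1) := fun k l =>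
    LinearMap.congr_fun hT.idempotent _
  have hcv : ∀ k l, ∑ j, T (Matrix.single k j 1) * T (Matrix.single j l 1) =
      T (Matrix.single k l 1) := fun k l => by
    rw [← conv_single, hc.2, one_smul]
  have hu' := fun i j => congrFun (congrFun hu i) j
  have u00 := hu' 0 0
  have u01 := hu' 0 1
  have u10 := hu' 1 0
  have u11 := hu' 1 1
  have i00 := hi 0 0
  have i01 := hi 0 1
  have i10 := hi 1 0
  -- Only traces of the convolution law are needed: for `E 0 0` and `E 1 1` they fix the rank of
  -- `T`.
  have cs : ∀ k l, ∑ i, (∑ j, T (Matrix.single k j 1) * T (Matrix.single j l 1)) i i =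
      ∑ i, T (Matrix.single k l 1) i i := fun k l => by rw [hcv]
  have c0 := cs 0 0
  have c1 := cs 1 1
  have d1 := hd 0 0 0 1
  have d2 := hd 0 0 1 0
  have d3 := hd 0 0 1 1
  have d4 := hd 0 1 0 1
  have d5 := hd 0 1 1 0
  have d6 := hd 0 1 1 1
  have d7 := hd 1 0 1 0
  have d8 := hd 1 0 1 1
  have d9 := hd 0 1 0 0
  have d10 := hd 1 1 0 1
  have d11 := hd 1 0 0 1
  rw [eq_sum_single T] at i00 i01 i10
  unfold HasTensorEntries
  beta_reduce
  simp only [Fin.sum_univ_two, Matrix.add_apply, Matrix.mul_apply] at c0 c1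
  clear cs
  replace i00 := fun i j => congrFun (congrFun i00 i) j
  replace i01 := fun i j => congrFun (congrFun i01 i) j
  replace i10 := fun i j => congrFun (congrFun i10 i) j
  generalize T (Matrix.single 0 0 1) = A at *
  generalize T (Matrix.single 0 1 1) = B at *
  generalize T (Matrix.single 1 0 1) = C at *
  generalize T (Matrix.single 1 1 1) = D at *
  have j11 := i00 0 0
  have j21 := i00 0 1
  have j31 := i00 1 0
  have j12 := i01 0 0
  have j22 := i01 0 1
  have j32 := i01 1 0
  have j13 := i10 0 0
  have j23 := i10 0 1
  have j33 := i10 1 0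
  simp only [Matrix.add_apply, Matrix.smul_apply, smul_eq_mul] at *
  simp only [Matrix.one_apply_eq, ne_eq, zero_ne_one, one_ne_zero, not_false_eq_true,
    Matrix.one_apply_ne] at u00 u01 u10 u11
  clear hd hi hcv hu hu' i00 i01 i10 hT hc
  obtain ⟨p, a00⟩ : ∃ p, A 0 0 = (1 + p) / 2 := ⟨2 * A 0 0 - 1, by ring⟩
  obtain ⟨m, a01⟩ : ∃ m, A 0 1 = m / 2 := ⟨2 * A 0 1, by ring⟩
  obtain ⟨n, a10⟩ : ∃ n, A 1 0 = n / 2 := ⟨2 * A 1 0, by ring⟩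
  obtain ⟨w, b01⟩ : ∃ w, B 0 1 = w / 2 := ⟨2 * B 0 1, by ring⟩
  obtain ⟨q, e01⟩ : ∃ q, C 0 1 = q / 2 := ⟨2 * C 0 1, by ring⟩
  obtain ⟨r, b10⟩ : ∃ r, B 1 0 = r / 2 := ⟨2 * B 1 0, by ring⟩
  have f00 : D 0 0 = (1 - p) / 2 := by linear_combination u00 - a00
  have f01 : D 0 1 = -(m / 2) := by linear_combination u01 - a01
  have f10 : D 1 0 = -(n / 2) := by linear_combination u10 - a10
  have a11 : A 1 1 = (1 - p) / 2 := d3.trans f00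
  have f11 : D 1 1 = (1 + p) / 2 := by linear_combination u11 - a11
  have b00 : B 0 0 = n / 2 := d9.trans a10
  have b11 : B 1 1 = -(n / 2) := d6.trans f10
  have e00 : C 0 0 = m / 2 := d2.symm.trans a01
  have e10 : C 1 0 = w / 2 := d5.symm.trans b01
  have e11 : C 1 1 = -(m / 2) := d8.trans f01
  simp only [a00, a01, a10, a11, b00, b01, b10, b11, e00, e01, e10, e11, f00, f01, f10, f11]
    at j11 j21 j31 j12 j22 j32 j13 j23 j33 c0 c1
  -- `c0 + c1` is the trace of `(T * T)(1)`; the idempotence entries reduce it to `1 + p + w = 2`.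
  have h : p + w = 1 := by linear_combination c0 + c1 - 2 * j11 - 2 * j22
  refine ⟨p, m, n, w, q, r, ⟨h, ?_, ?_, ?_, ?_, ?_, ?_⟩, ?_, ?_, ?_, ?_⟩
  -- Idempotence entries become minors once `p + w = 1`: for instance `p ^ 2 + m * n = p` gives `m *
  -- n = p * w`.
  · linear_combination -2 * j11 + p * h
  · linear_combination -2 * j23 + q * h
  · linear_combination -2 * j32 + r * h
  · linear_combination -4 * j13 + 2 * m * h
  · linear_combination -4 * j12 + 2 * n * h
  · linear_combination -4 * (2 * j11 - h * p + (p + w) * h / 2 - (j11 + j22))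
  · rw [A.eta_fin_two, a00, a01, a10, a11]
  · rw [B.eta_fin_two, b00, b01, b10, b11]
  · rw [C.eta_fin_two, e00, e01, e10, e11]
  · rw [D.eta_fin_two, f00, f01, f10, f11]

theorem isBiprojection_and_isConvStable_one_iff (T : Module.End ℂ (Matrix (Fin 2) (Fin 2) ℂ)) :
    IsBiprojection T ∧ IsConvStable 1 T ↔ ∃ p m n w q r : ℂ, IsUnitSquare p m n w q r ∧
      HasTensorEntries (fun i j => T (Matrix.single i j 1)) p m n w q r := by
  constructor
  · rintro ⟨hT, hc⟩
    exact exists_hasTensorEntries hT hc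
  · rintro ⟨p, m, n, w, q, r, h, hT⟩
    obtain ⟨a, b, c, habc, rfl⟩ := hT.eq_involutionProjection h
    exact isBiprojection_involutionProjection (by simp [Matrix.trace_fin_two])
      (involution_mul_self habc)

/-! ### The three parametric families -/

theorem exists_hasTensorEntries_iff (A : Fin 2 → Fin 2 → Matrix (Fin 2) (Fin 2) ℂ) :
    (∃ p m n w q r : ℂ, IsUnitSquare p m n w q r ∧ HasTensorEntries A p m n w q r) ↔
      ((∃ s : ℂ,
          A 0 0 = !![1, -s; 0, 0] ∧
          A 0 1 = !![0, 0; 0, 0] ∧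
          A 1 0 = !![-s, 2 * s ^ 2; 0, s] ∧
          A 1 1 = !![0, s; 0, 1]) ∨
       (∃ u : ℂ, u ≠ 0 ∧
          A 0 0 = !![1 / 2, 0; 0, 1 / 2] ∧
          A 0 1 = !![0, 1 / 2; 1 / (4 * u), 0] ∧
          A 1 0 = !![0, u; 1 / 2, 0] ∧
          A 1 1 = !![1 / 2, 0; 0, 1 / 2]) ∨
       (∃ k t : ℂ, k ≠ 1 / 2 ∧ t ≠ 0 ∧
          A 0 0 = !![k, (k - 1) * (k - 1 / 2) / t; -t, 1 - k] ∧
          A 0 1 = !![-t, 1 - k; t ^ 2 / (k - 1 / 2), t] ∧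
          A 1 0 = !![(k - 1) * (k - 1 / 2) / t, (k - 1) ^ 2 * (k - 1 / 2) / t ^ 2;
                     1 - k, -((k - 1) * (k - 1 / 2) / t)] ∧
          A 1 1 = !![1 - k, -((k - 1) * (k - 1 / 2) / t); t, k])) := by
  constructor
  · rintro ⟨p, m, n, w, q, r, ⟨h1, h2, h3, h4, h5, h6, h7⟩, a1, a2, a3, a4⟩
    rw [a1, a2, a3, a4]
    -- With `r = c ^ 2` and `p = a ^ 2`, the families are `c = 0`, then `a = 0`, then both nonzero,
    -- where `n ^ 2 = p * r` forces `n ≠ 0`.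
    by_cases hr : r = 0
    · left
      subst hr
      have hn : n = 0 := by simpa using h4.symm
      have hw : w = 0 := by simpa using h7.symm
      subst hn hw
      have hp : p = 1 := by simpa using h1
      subst hp
      have hq : q = m ^ 2 := by simpa using h3
      subst hq
      refine ⟨-(m / 2), ?_, ?_, ?_, ?_⟩ <;> ext i j <;> fin_cases i <;> fin_cases j <;> simp
      ring
    by_cases hp : p = 0
    · right; left
      subst hp
      have hm : m = 0 := by simpa using h3.symm
      have hn : n = 0 := by simpa using h4.symm
      have hw : w = 1 := by simpa using h1
      subst hm hn hw
      have hq : q ≠ 0 := by rintro rfl; simp at h7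
      have hr' : r / 2 = 1 / (4 * (q / 2)) := by
        field_simp; linear_combination 4 * h7
      refine ⟨q / 2, div_ne_zero hq two_ne_zero, ?_⟩
      rw [← hr']
      simp
    · right; right
      have hn : n ≠ 0 := by rintro rfl; simp_all
      have hk : (1 + p) / 2 - 1 / 2 = p / 2 := by ring
      have hw : w = 1 - p := by linear_combination h1
      subst hw
      refine ⟨(1 + p) / 2, -(n / 2), ?_, neg_ne_zero.2 (div_ne_zero hn two_ne_zero), ?_⟩
      · rw [← sub_ne_zero, hk]; exact div_ne_zero hp two_ne_zero
      have e1 : ((1 + p) / 2 - 1) * ((1 + p) / 2 - 1 / 2) / -(n / 2) = m / 2 := by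
        field_simp; linear_combination h2
      have e2 : (-(n / 2)) ^ 2 / ((1 + p) / 2 - 1 / 2) = r / 2 := by
        rw [hk]; field_simp; linear_combination -h4
      have e3 : ((1 + p) / 2 - 1) ^ 2 * ((1 + p) / 2 - 1 / 2) / (-(n / 2)) ^ 2 = q / 2 := by
        rw [hk]; field_simp; grind
      rw [e1, e2, e3]
      refine ⟨?_, ?_, ?_, ?_⟩ <;> ext i j <;> fin_cases i <;> fin_cases j <;> simp <;> ring
  · rintro (⟨s, h⟩ | ⟨u, hu, h⟩ | ⟨k, t, hk, ht, h⟩)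
    · refine ⟨1, -2 * s, 0, 0, 4 * s ^ 2, 0, ?_, ?_⟩
      · constructor <;> ring
      · obtain ⟨a1, a2, a3, a4⟩ := h
        refine ⟨?_, ?_, ?_, ?_⟩ <;> simp only [a1, a2, a3, a4] <;> ext i j <;>
          fin_cases i <;> fin_cases j <;> simp <;> ring
    · refine ⟨0, 0, 0, 1, 2 * u, 1 / (2 * u), ?_, ?_⟩
      · constructor <;> field_simp <;> ring
      · obtain ⟨a1, a2, a3, a4⟩ := h
        refine ⟨?_, ?_, ?_, ?_⟩ <;> simp only [a1, a2, a3, a4] <;> ext i j <;>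
          fin_cases i <;> fin_cases j <;> simp; ring
    · have hk' : k - 1 / 2 ≠ 0 := sub_ne_zero.2 hk
      -- The shift makes the denominator `k - 1 / 2` a single variable.
      obtain ⟨v, rfl⟩ : ∃ v, k = v + 1 / 2 := ⟨k - 1 / 2, by ring⟩
      rw [add_sub_cancel_right] at hk' h
      refine ⟨2 * v, 2 * ((v - 1 / 2) * v / t), -2 * t, 1 - 2 * v,
        2 * ((v - 1 / 2) ^ 2 * v / t ^ 2), 2 * (t ^ 2 / v), ?_, ?_⟩
      · constructor <;> field_simp <;> ring
      · obtain ⟨a1, a2, a3, a4⟩ := h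
        refine ⟨?_, ?_, ?_, ?_⟩ <;> simp only [a1, a2, a3, a4] <;> ext i j <;>
          fin_cases i <;> fin_cases j <;> simp <;> ring

/-! ### The image as a subalgebra -/

theorem toSubmodule_adjoin_involution {H : Matrix (Fin 2) (Fin 2) ℂ} (hH : H * H = 1) :
    Subalgebra.toSubmodule (Algebra.adjoin ℂ {H}) = Submodule.span ℂ {1, H} := by
  apply le_antisymm
  · intro X hX
    induction hX using Algebra.adjoin_induction with
    | mem x hx => exact Submodule.subset_span (by simp_all)
    | algebraMap r =>
      rw [Algebra.algebraMap_eq_smul_one]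
      exact Submodule.smul_mem _ _ (Submodule.subset_span (by simp))
    | add x y _ _ hx hy => exact add_mem hx hy
    | mul x y _ _ hx hy =>
      obtain ⟨a, b, rfl⟩ := Submodule.mem_span_pair.1 hx
      obtain ⟨c, d, rfl⟩ := Submodule.mem_span_pair.1 hy
      refine Submodule.mem_span_pair.2 ⟨a * c + b * d, a * d + b * c, ?_⟩
      simp only [add_mul, mul_add, smul_mul_smul_comm, one_mul, mul_one, hH]
      module
  · rw [Submodule.span_le]
    rintro X (rfl | rfl)
    · exact one_mem (Algebra.adjoin ℂ {H})
    · exact Algebra.self_mem_adjoin_singleton ℂ _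

theorem range_involutionProjection {H : Matrix (Fin 2) (Fin 2) ℂ} (h : H.trace = 0)
    (hH : H * H = 1) :
    LinearMap.range (involutionProjection H) = Submodule.span ℂ {1, H} := by
  apply le_antisymm
  · rintro _ ⟨X, rfl⟩
    exact Submodule.mem_span_pair.2 ⟨_, _, rfl⟩
  · rw [Submodule.span_le]
    rintro X (rfl | rfl)
    · exact ⟨1, involutionProjection_one h⟩
    · exact ⟨_, involutionProjection_self h hH⟩

theorem finrank_adjoin_involution {H : Matrix (Fin 2) (Fin 2) ℂ} (h : H.trace = 0)
    (hH : H * H = 1) : Module.finrank ℂ (Algebra.adjoin ℂ {H}) = 2 := by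
  rw [← Subalgebra.finrank_toSubmodule, toSubmodule_adjoin_involution hH]
  have hli : LinearIndependent ℂ ![1, H] := by
    refine LinearIndependent.pair_iff.2 fun s t hst => ?_
    -- Pairing with `1` and with `H` under the trace form isolates each coefficient.
    have hs : s = 0 := by simpa [h] using congrArg Matrix.trace hst
    have ht : t = 0 := by
      simpa [add_mul, h, hH] using congrArg (fun X : Matrix (Fin 2) (Fin 2) ℂ => (X * H).trace) hst
    exact ⟨hs, ht⟩
  have hr := finrank_span_eq_card hli
  rwa [Matrix.range_cons, Matrix.range_cons, Matrix.range_empty, Set.union_empty,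
    Set.singleton_union] at hr

theorem adjoin_smul_singleton {c : ℂ} (hc : c ≠ 0) (H : Matrix (Fin 2) (Fin 2) ℂ) :
    Algebra.adjoin ℂ {c • H} = Algebra.adjoin ℂ {H} := by
  apply le_antisymm <;> rw [Algebra.adjoin_le_iff, Set.singleton_subset_iff]
  · exact Subalgebra.smul_mem _ (Algebra.self_mem_adjoin_singleton ℂ _) c
  · have := Subalgebra.smul_mem (Algebra.adjoin ℂ {c • H}) (Algebra.self_mem_adjoin_singleton ℂ _) c⁻¹
    rwa [inv_smul_smul₀ hc] at this

end MatrixFrobenius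

theorem proposition3p14 (T : Module.End ℂ (Matrix (Fin 2) (Fin 2) ℂ))
    (A : Fin 2 → Fin 2 → Matrix (Fin 2) (Fin 2) ℂ)
    (hA : ∀ i j, A i j = T (Matrix.single i j 1)) :
    ((MatrixFrobenius.IsBiprojection T ∧ MatrixFrobenius.IsConvStable 1 T) ↔
      ((∃ s : ℂ,
          A 0 0 = !![1, -s; 0, 0] ∧
          A 0 1 = !![0, 0; 0, 0] ∧
          A 1 0 = !![-s, 2 * s ^ 2; 0, s] ∧
          A 1 1 = !![0, s; 0, 1]) ∨
       (∃ u : ℂ, u ≠ 0 ∧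
          A 0 0 = !![1 / 2, 0; 0, 1 / 2] ∧
          A 0 1 = !![0, 1 / 2; 1 / (4 * u), 0] ∧
          A 1 0 = !![0, u; 1 / 2, 0] ∧
          A 1 1 = !![1 / 2, 0; 0, 1 / 2]) ∨
       (∃ k t : ℂ, k ≠ 1 / 2 ∧ t ≠ 0 ∧
          A 0 0 = !![k, (k - 1) * (k - 1 / 2) / t; -t, 1 - k] ∧
          A 0 1 = !![-t, 1 - k; t ^ 2 / (k - 1 / 2), t] ∧
          A 1 0 = !![(k - 1) * (k - 1 / 2) / t, (k - 1) ^ 2 * (k - 1 / 2) / t ^ 2;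
                     1 - k, -((k - 1) * (k - 1 / 2) / t)] ∧
          A 1 1 = !![1 - k, -((k - 1) * (k - 1 / 2) / t); t, k]))) ∧
    (MatrixFrobenius.IsBiprojection T ∧ MatrixFrobenius.IsConvStable 1 T →
      ∃ S : Subalgebra ℂ (Matrix (Fin 2) (Fin 2) ℂ),
        Subalgebra.toSubmodule S = LinearMap.range T ∧
        Module.finrank ℂ S = 2 ∧
        (A 0 1 ≠ 0 → S = Algebra.adjoin ℂ {A 0 1}) ∧
        (A 1 0 ≠ 0 → S = Algebra.adjoin ℂ {A 1 0}) ∧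
        (A 0 1 = 0 ∧ A 1 0 = 0 →
          (∀ X, T X = Matrix.diagonal X.diag) ∧ ∀ X, X ∈ S ↔ X.IsDiag)) := by
  obtain rfl : A = fun i j => T (Matrix.single i j 1) := funext fun i => funext fun j => hA i j
  rw [MatrixFrobenius.isBiprojection_and_isConvStable_one_iff]
  refine ⟨MatrixFrobenius.exists_hasTensorEntries_iff _, ?_⟩
  rintro ⟨p, m, n, w, q, r, h, hT⟩
  obtain ⟨a, b, c, habc, rfl⟩ := hT.eq_involutionProjection h
  have htr : (!![a, b; c, -a]).trace = 0 := by simp [Matrix.trace_fin_two]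
  have hsq := MatrixFrobenius.involution_mul_self habc
  -- Both off-diagonal values are multiples of `H`, so each generates the same algebra as `H` when
  -- nonzero, and both vanish exactly when `b = c = 0`.
  have h01 : MatrixFrobenius.involutionProjection !![a, b; c, -a] (Matrix.single 0 1 1) =
      (c / 2) • !![a, b; c, -a] := by
    simp [MatrixFrobenius.involutionProjection_single]
  have h10 : MatrixFrobenius.involutionProjection !![a, b; c, -a] (Matrix.single 1 0 1) =
      (b / 2) • !![a, b; c, -a] := by
    simp [MatrixFrobenius.involutionProjection_single]
  have hH : !![a, b; c, -a] ≠ 0 := by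
    intro h0
    rw [h0, zero_mul] at hsq
    exact zero_ne_one hsq
  refine ⟨Algebra.adjoin ℂ {!![a, b; c, -a]}, ?_, MatrixFrobenius.finrank_adjoin_involution htr hsq,
    fun hne => ?_, fun hne => ?_, ?_⟩
  · rw [MatrixFrobenius.toSubmodule_adjoin_involution hsq,
      MatrixFrobenius.range_involutionProjection htr hsq]
  · beta_reduce at hne ⊢
    rw [h01] at hne ⊢
    rw [MatrixFrobenius.adjoin_smul_singleton (smul_ne_zero_iff.1 hne).1]
  · beta_reduce at hne ⊢
    rw [h10] at hne ⊢
    rw [MatrixFrobenius.adjoin_smul_singleton (smul_ne_zero_iff.1 hne).1]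
  · rintro ⟨hc, hb⟩
    beta_reduce at hc hb
    rw [h01, smul_eq_zero_iff_left hH, div_eq_zero_iff, or_iff_left two_ne_zero] at hc
    rw [h10, smul_eq_zero_iff_left hH, div_eq_zero_iff, or_iff_left two_ne_zero] at hb
    subst hb hc
    have hdiag : ∀ X, MatrixFrobenius.involutionProjection !![a, 0; 0, -a] X =
        Matrix.diagonal X.diag := fun X => by
      have ha : a ^ 2 = 1 := by simpa using habc
      ext i j
      fin_cases i <;> fin_cases j <;>
        simp [MatrixFrobenius.involutionProjection_apply, Matrix.trace_fin_two, Matrix.vecMul,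
          dotProduct]
      · linear_combination (X 0 0 - X 1 1) / 2 * ha
      · linear_combination (X 1 1 - X 0 0) / 2 * ha
    refine ⟨hdiag, fun X => ?_⟩
    rw [Matrix.isDiag_iff_diagonal_diag, ← Subalgebra.mem_toSubmodule, MatrixFrobenius.toSubmodule_adjoin_involution hsq,
      ← MatrixFrobenius.range_involutionProjection htr hsq]
    constructor
    · rintro ⟨Y, rfl⟩
      rw [hdiag, Matrix.diag_diagonal]
    · intro hX
      exact ⟨X, (hdiag X).trans hX⟩
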